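/- Let $n\ge 0$, let $E=\mathbb C^n$ with basis $x^1,\dots,x^n$, let $R\subseteq E\otimes E$ be a subspace, and let $\mathcal A=T(E)/(R)$ be the quadratic algebra generated by the $x^k$ with relations $R$. Assume that 1. $\mathcal A$ is a $*$-algebra with hermitian generators $x^k$, i.e. $\sum r_{k\ell}\,x^k\otimes x^\ell\in R$ implies $\sum \overline{r_{\ell k}}\,x^k\otimes x^\ell\in R$; 2. $\mathcal A$ is Koszul, i.e. its Koszul complex $\cdots\to\mathcal A\otimes J_{m+1}\xrightarrow{\,b\,}\mathcal A\otimes J_m\to\cdots\to\mathcal A\otimes E\to\mathcal A\to 0$ is exact in all degrees $m\ge 1$, where $J_0=\mathbb C$, $J_1=E$, $J_m=\bigcap_{r+s+2=m}E^{\otimes r}\otimes R\otimes E^{\otimes s}$ for $m\geq 2$, and $b(a\otimes(y_0\otimes y_1\otimes\cdots\otimes y_m))=ay_0\otimes(y_1\otimes\cdots\otimes y_m)$; 3. $\sum_{k=1}^n (x^k)^2$ is central in $\mathcal A$. (In particular this covers every noncommutative Euclidean space $\mathbb R^n$, for which $\mathcal A$ is required to be, in addition, Artin–Schelter regular of global dimension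 $n$.) Let $(\theta_k)$ be the basis of $E^*$ dual to $(x^k)$, let $R^\perp=\{\sum\omega^{k\ell}\theta_k\otimes\theta_\ell : \sum_{k,\ell}\omega^{k\ell}r_{k\ell}=0 \text{ for all } \sum r_{k\ell}\,x^k\otimes x^\ell\in R\}$, and let $\mathcal A^!=T(E^*)/(R^\perp)=\bigoplus_p\mathcal A^!_p$ be the Koszul dual of $\mathcal A$. Let $C\ell(\mathcal A)$ be the generalized Clifford algebra, the unital complex algebra generated by $\Gamma_1,\dots,\Gamma_n$ with the relations $$\sum_{k,\ell}\omega^{k\ell}\,\Gamma_k\Gamma_\ell=\Big(\sum_i\omega^{ii}\Big)1\qquad\text{for all }\sum\omega^{k\ell}\theta_k\otimes\theta_\ell\in R^\perp .$$ Filter it by $F^q=\{\text{elements of degree}\le q\text{ in the }\Gamma_k\}$ with $F^{-1}=0$, and let $\mathrm{gr}(C\ell(\mathcal A))=\bigoplus_{p\ge 0}F^p/F^{p-1}$. Then the canonical homomorphism $$\mathrm{can}:\mathcal A^!\to\mathrm{gr}(C\ell(\mathcal A)),\qquad \theta_k\mapsto[\Gamma_k]\in F^1/F^0,$$ is an isomorphism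 of graded algebras: it is bijective and maps $\mathcal A^!_p$ onto $F^p/F^{p-1}$ for every $p$. In particular $\dim C\ell(\mathcal A)=\dim\mathcal A^!$. -/

import Mathlib

noncomputable section

namespace NCEuclid

/-! ### The associated graded algebra of an algebra filtered by a generating subspace -/

section AssociatedGraded

variable {B : Type} [Ring B] [Algebra ℂ B]

/-- The filtration of `B` by degree in a subspace `S` of generators: `filt S q` is the span of the
products of at most `q` elements of `S`, that is, `(ℂ·1 + S)^q`. -/
def filt (S : Submodule ℂ B) (q : ℕ) : Submodule ℂ B := (1 ⊔ S) ^ q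

/-- The previous step `F^{q-1}` of the filtration, with `F^{-1} = 0`. -/
def filtPrev (S : Submodule ℂ B) : ℕ → Submodule ℂ B
  | 0 => ⊥
  | q + 1 => filt S q

theorem filt_mul_mem (S : Submodule ℂ B) {i j : ℕ} {a b : B} (ha : a ∈ filt S i)
    (hb : b ∈ filt S j) : a * b ∈ filt S (i + j) := by
  unfold filt at *
  rw [pow_add]
  exact Submodule.mul_mem_mul ha hb

theorem filtPrev_mul_mem (S : Submodule ℂ B) {i j : ℕ} {a b : B} (ha : a ∈ filtPrev S i)
    (hb : b ∈ filt S j) : a * b ∈ filtPrev S (i + j) := by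
  cases i with
  | zero =>
    have h0 : a = 0 := by simpa [filtPrev] using ha
    simp [h0]
  | succ i =>
    rw [Nat.succ_add]
    exact filt_mul_mem S ha hb

theorem mul_filtPrev_mem (S : Submodule ℂ B) {i j : ℕ} {a b : B} (ha : a ∈ filt S i)
    (hb : b ∈ filtPrev S j) : a * b ∈ filtPrev S (i + j) := by
  cases j with
  | zero =>
    have h0 : b = 0 := by simpa [filtPrev] using hb
    simp [h0]
  | succ j => exact filt_mul_mem S ha hb

theorem algebraMap_mem_filt (S : Submodule ℂ B) (c : ℂ) : algebraMap ℂ B c ∈ filt S 0 := by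
  simp [filt, Submodule.mem_one]

theorem mem_filt_one (S : Submodule ℂ B) {a : B} (ha : a ∈ S) : a ∈ filt S 1 := by
  simpa [filt] using Submodule.mem_sup_right ha

theorem algebraMap_mem_filt_one (S : Submodule ℂ B) (c : ℂ) : algebraMap ℂ B c ∈ filt S 1 := by
  simpa [filt] using Submodule.mem_sup_left (Submodule.mem_one.2 ⟨c, rfl⟩)

/-- The component `F^p / F^{p-1}` of the associated graded algebra. -/
def Gr (S : Submodule ℂ B) (p : ℕ) : Type :=
  filt S p ⧸ (filtPrev S p).submoduleOf (filt S p)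

instance Gr.addCommGroup (S : Submodule ℂ B) (p : ℕ) : AddCommGroup (Gr S p) :=
  inferInstanceAs (AddCommGroup (filt S p ⧸ (filtPrev S p).submoduleOf (filt S p)))

instance Gr.module (S : Submodule ℂ B) (p : ℕ) : Module ℂ (Gr S p) :=
  inferInstanceAs (Module ℂ (filt S p ⧸ (filtPrev S p).submoduleOf (filt S p)))

/-- The projection `F^p → F^p / F^{p-1}`. -/
def Gr.mkQ (S : Submodule ℂ B) (p : ℕ) : filt S p →ₗ[ℂ] Gr S p :=
  Submodule.mkQ ((filtPrev S p).submoduleOf (filt S p))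

/-- The class in `F^p / F^{p-1}` of an element of `F^p`. -/
def Gr.cls (S : Submodule ℂ B) (p : ℕ) (a : B) (ha : a ∈ filt S p) : Gr S p :=
  Gr.mkQ S p ⟨a, ha⟩

theorem Gr.exists_cls (S : Submodule ℂ B) {p : ℕ} (x : Gr S p) :
    ∃ (a : B) (ha : a ∈ filt S p), x = Gr.cls S p a ha := by
  obtain ⟨⟨a, ha⟩, rfl⟩ := Submodule.Quotient.mk_surjective _ x
  exact ⟨a, ha, rfl⟩

theorem Gr.cls_eq_zero (S : Submodule ℂ B) {p : ℕ} {a : B} (ha : a ∈ filt S p) :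
    Gr.cls S p a ha = 0 ↔ a ∈ filtPrev S p :=
  Submodule.Quotient.mk_eq_zero _

/-- The multiplication `F^i × F^j → F^{i+j}`. -/
def filtMul (S : Submodule ℂ B) (i j : ℕ) : filt S i →ₗ[ℂ] filt S j →ₗ[ℂ] filt S (i + j) :=
  LinearMap.mk₂ ℂ (fun a b => ⟨a.1 * b.1, filt_mul_mem S a.2 b.2⟩)
    (fun a a' b => Subtype.ext (add_mul a.1 a'.1 b.1))
    (fun c a b => Subtype.ext (smul_mul_assoc c a.1 b.1))
    (fun a b b' => Subtype.ext (mul_add a.1 b.1 b'.1))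
    (fun c a b => Subtype.ext (mul_smul_comm c a.1 b.1))

/-- The induced multiplication `F^i/F^{i-1} × F^j/F^{j-1} → F^{i+j}/F^{i+j-1}`,
`[a] [b] = [a b]`. -/
def Gr.mul (S : Submodule ℂ B) (i j : ℕ) : Gr S i →ₗ[ℂ] Gr S j →ₗ[ℂ] Gr S (i + j) :=
  Submodule.liftQ ((filtPrev S i).submoduleOf (filt S i))
    (LinearMap.flip <| Submodule.liftQ ((filtPrev S j).submoduleOf (filt S j))
      (LinearMap.flip <| (filtMul S i j).compr₂ (Gr.mkQ S (i + j))) (by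
        rintro ⟨b, hb⟩ h
        ext ⟨a, ha⟩
        exact (Submodule.Quotient.mk_eq_zero _).2 (mul_filtPrev_mem S ha h))) (by
    rintro ⟨a, ha⟩ h
    ext ⟨b, hb⟩
    exact (Submodule.Quotient.mk_eq_zero _).2 (filtPrev_mul_mem S h hb))

theorem Gr.mul_cls (S : Submodule ℂ B) {i j : ℕ} {a b : B} (ha : a ∈ filt S i)
    (hb : b ∈ filt S j) :
    Gr.mul S i j (Gr.cls S i a ha) (Gr.cls S j b hb) =
      Gr.cls S (i + j) (a * b) (filt_mul_mem S ha hb) := rfl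

theorem Gr.mk_cls_congr (S : Submodule ℂ B) {i j : ℕ} (hij : i = j) {a b : B} (hab : a = b)
    (ha : a ∈ filt S i) (hb : b ∈ filt S j) :
    (GradedMonoid.mk i (Gr.cls S i a ha) : GradedMonoid (Gr S)) =
      GradedMonoid.mk j (Gr.cls S j b hb) := by
  subst hij hab
  rfl

instance Gr.gOne (S : Submodule ℂ B) : GradedMonoid.GOne (Gr S) where
  one := Gr.cls S 0 1 (by simpa using algebraMap_mem_filt S 1)

instance Gr.gMul (S : Submodule ℂ B) : GradedMonoid.GMul (Gr S) where
  mul {i j} x y := Gr.mul S i j x y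

instance Gr.gRing (S : Submodule ℂ B) : DirectSum.GRing (Gr S) where
  mul_zero x := map_zero (Gr.mul S _ _ x)
  zero_mul y := LinearMap.map_zero₂ (Gr.mul S _ _) y
  mul_add x y z := map_add (Gr.mul S _ _ x) y z
  add_mul x y z := LinearMap.map_add₂ (Gr.mul S _ _) x y z
  one_mul := by
    rintro ⟨i, x⟩
    obtain ⟨a, ha, rfl⟩ := Gr.exists_cls S x
    exact Gr.mk_cls_congr S (zero_add i) (one_mul a) _ _
  mul_one := by
    rintro ⟨i, x⟩
    obtain ⟨a, ha, rfl⟩ := Gr.exists_cls S x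
    exact Gr.mk_cls_congr S (add_zero i) (mul_one a) _ _
  mul_assoc := by
    rintro ⟨i, x⟩ ⟨j, y⟩ ⟨k, z⟩
    obtain ⟨a, ha, rfl⟩ := Gr.exists_cls S x
    obtain ⟨b, hb, rfl⟩ := Gr.exists_cls S y
    obtain ⟨c, hc, rfl⟩ := Gr.exists_cls S z
    exact Gr.mk_cls_congr S (add_assoc i j k) (mul_assoc a b c) _ _
  natCast m := (m : ℕ) • GradedMonoid.GOne.one
  natCast_zero := zero_smul _ _
  natCast_succ m := succ_nsmul _ _
  intCast m := (m : ℤ) • GradedMonoid.GOne.one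
  intCast_ofNat m := natCast_zsmul _ _
  intCast_negSucc_ofNat m := negSucc_zsmul _ _

instance Gr.gAlgebra (S : Submodule ℂ B) : DirectSum.GAlgebra ℂ (Gr S) where
  toFun :=
    { toFun := fun c => Gr.cls S 0 (algebraMap ℂ B c) (algebraMap_mem_filt S c)
      map_zero' := (Gr.cls_eq_zero S _).2 (by simp)
      map_add' := fun c d =>
        (congrArg (Gr.mkQ S 0) (Subtype.ext (map_add (algebraMap ℂ B) c d))).trans
          (map_add (Gr.mkQ S 0) ⟨_, algebraMap_mem_filt S c⟩ ⟨_, algebraMap_mem_filt S d⟩) }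
  map_one := congrArg (Gr.mkQ S 0) (Subtype.ext (map_one (algebraMap ℂ B)))
  map_mul c d := Gr.mk_cls_congr S (zero_add 0).symm (map_mul (algebraMap ℂ B) c d) _ _
  commutes := by
    rintro c ⟨i, x⟩
    obtain ⟨a, ha, rfl⟩ := Gr.exists_cls S x
    exact Gr.mk_cls_congr S ((zero_add i).trans (add_zero i).symm) (Algebra.commutes c a) _ _
  smul_def := by
    rintro c ⟨i, x⟩
    obtain ⟨a, ha, rfl⟩ := Gr.exists_cls S x
    exact Gr.mk_cls_congr S (zero_add i).symm (Algebra.smul_def c a)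
      ((filt S i).smul_mem c ha) _

end AssociatedGraded

/-! ### Quadratic algebras on generators `x^1, …, x^n` -/

/-- The free algebra `ℂ⟨x^1, …, x^n⟩`, i.e. the tensor algebra of `E = ℂ^n`. -/
abbrev Free (n : ℕ) : Type := FreeAlgebra ℂ (Fin n)

/-- The element `∑_{k,l} r_{kl} x^k ⊗ x^l` of `E ⊗ E` with coefficient array `r`. In this way
`E ⊗ E` is identified with the space of `n × n` complex matrices. -/
def quad {n : ℕ} (r : Matrix (Fin n) (Fin n) ℂ) : Free n :=
  ∑ k, ∑ l, r k l • (FreeAlgebra.ι ℂ k * FreeAlgebra.ι ℂ l)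

/-- The relations `∑ r_{kl} x^k x^l = 0` for `r ∈ R`. -/
def QAlg.Rel {n : ℕ} (R : Submodule ℂ (Matrix (Fin n) (Fin n) ℂ)) (a b : Free n) : Prop :=
  ∃ r ∈ R, a = quad r ∧ b = 0

/-- The homogeneous quadratic algebra `A(E, R) = T(E)/(R)`, where `R ⊆ E ⊗ E`. -/
abbrev QAlg {n : ℕ} (R : Submodule ℂ (Matrix (Fin n) (Fin n) ℂ)) : Type :=
  RingQuot (QAlg.Rel R)

/-- The generators of `A(E, R)`. -/
def QAlg.gen {n : ℕ} (R : Submodule ℂ (Matrix (Fin n) (Fin n) ℂ)) (k : Fin n) : QAlg R :=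
  RingQuot.mkAlgHom ℂ (QAlg.Rel R) (FreeAlgebra.ι ℂ k)

/-- The homogeneous component of degree `p` of `A(E, R)`: the span of the products of `p`
generators. -/
def QAlg.comp {n : ℕ} (R : Submodule ℂ (Matrix (Fin n) (Fin n) ℂ)) (p : ℕ) :
    Submodule ℂ (QAlg R) :=
  Submodule.span ℂ (Set.range (QAlg.gen R)) ^ p

/-- The orthogonal `R^⊥ ⊆ E* ⊗ E*` of the space of relations, for the pairing
`⟨ω, r⟩ = ∑_{k,l} ω^{kl} r_{kl}`, in terms of the dual basis `θ_k` of `x^k`. -/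
def perp {n : ℕ} (R : Submodule ℂ (Matrix (Fin n) (Fin n) ℂ)) :
    Submodule ℂ (Matrix (Fin n) (Fin n) ℂ) where
  carrier := {ω | ∀ r ∈ R, ∑ k, ∑ l, ω k l * r k l = 0}
  add_mem' := fun {a b} ha hb r hr => by
    simp only [Matrix.add_apply, add_mul, Finset.sum_add_distrib, ha r hr, hb r hr, add_zero]
  zero_mem' := fun r _ => by simp
  smul_mem' := fun c a ha r hr => by
    simp only [Matrix.smul_apply, smul_eq_mul, mul_assoc, ← Finset.mul_sum, ha r hr, mul_zero]

/-- The Koszul dual `A^! = A(E*, R^⊥)` of `A = A(E, R)`; its generators are the `θ_k`. -/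
abbrev KoszulDual {n : ℕ} (R : Submodule ℂ (Matrix (Fin n) (Fin n) ℂ)) : Type := QAlg (perp R)

/-! ### Koszul algebras -/

/-- The space `A^{!*}_m = ⋂_{r+s+2=m} E^{⊗r} ⊗ R ⊗ E^{⊗s} ⊆ E^{⊗m}` (all of `E^{⊗m}` for
`m = 0, 1`). Elements of `E^{⊗m}` are given by their arrays of coefficients, and `t` lies in
`E^{⊗i} ⊗ R ⊗ E^{⊗(m-i-2)}` iff for all values of the other indices the matrix formed by the
indices in the positions `i, i + 1` is in `R`. -/
def koszulSpace {n : ℕ} (R : Submodule ℂ (Matrix (Fin n) (Fin n) ℂ)) (m : ℕ) :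
    Set ((Fin m → Fin n) → ℂ) :=
  {t | ∀ (i : ℕ) (hi : i + 1 < m) (I : Fin m → Fin n),
    (Matrix.of fun k l : Fin n =>
      t (Function.update (Function.update I ⟨i, Nat.lt_of_succ_lt hi⟩ k) ⟨i + 1, hi⟩ l)) ∈ R}

/-- The term `A ⊗ A^{!*}_m` of the Koszul complex, as a subspace of `A ⊗ E^{⊗m}`. The elements
of the latter are the arrays `f` of elements of `A`, standing for
`∑_I f(I) ⊗ x^{I_1} ⊗ ⋯ ⊗ x^{I_m}`. -/
def koszulChains {n : ℕ} (R : Submodule ℂ (Matrix (Fin n) (Fin n) ℂ)) (m : ℕ) :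
    Submodule ℂ ((Fin m → Fin n) → QAlg R) :=
  Submodule.span ℂ {f | ∃ (a : QAlg R), ∃ t ∈ koszulSpace R m, f = fun I => t I • a}

/-- The Koszul differential `b : A ⊗ E^{⊗(m+1)} → A ⊗ E^{⊗m}`,
`b(a ⊗ (x_0 ⊗ x_1 ⊗ ⋯ ⊗ x_m)) = a x_0 ⊗ (x_1 ⊗ ⋯ ⊗ x_m)`. -/
def koszulB {n : ℕ} (R : Submodule ℂ (Matrix (Fin n) (Fin n) ℂ)) (m : ℕ)
    (f : (Fin (m + 1) → Fin n) → QAlg R) : (Fin m → Fin n) → QAlg R :=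
  fun I => ∑ k, f (Fin.cons k I) * QAlg.gen R k

/-- `A = A(E, R)` is a Koszul algebra: its Koszul complex
`⋯ → A ⊗ A^{!*}_{m+1} → A ⊗ A^{!*}_m → ⋯ → A ⊗ E → A → 0` is exact in all positive degrees. -/
def IsKoszul {n : ℕ} (R : Submodule ℂ (Matrix (Fin n) (Fin n) ℂ)) : Prop :=
  ∀ (m : ℕ), ∀ f ∈ koszulChains R (m + 1), koszulB R m f = 0 →
    ∃ g ∈ koszulChains R (m + 2), koszulB R (m + 1) g = f

/-! ### The generalized Clifford algebra -/

/-- The relations `∑_{k,l} ω^{kl} Γ_k Γ_l = ∑_i ω^{ii} 1` for `ω ∈ R^⊥`. -/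
def Cl.Rel {n : ℕ} (R : Submodule ℂ (Matrix (Fin n) (Fin n) ℂ)) (a b : Free n) : Prop :=
  ∃ ω ∈ perp R, a = quad ω ∧ b = algebraMap ℂ (Free n) (∑ i, ω i i)

/-- The generalized Clifford algebra `Cℓ(A)` of `A = A(E, R)`: it is generated by
`Γ_1, …, Γ_n` with relations `∑_{k,l} ω^{kl} Γ_k Γ_l = ∑_i ω^{ii} 1` for `ω ∈ R^⊥`, that is, for all
quadratic relations `∑ ω^{kl} θ_k θ_l = 0` of `A^!` (both sides are linear in `ω`, so it is the same
to impose them for the elements of a basis of `R^⊥`). -/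
abbrev Cl {n : ℕ} (R : Submodule ℂ (Matrix (Fin n) (Fin n) ℂ)) : Type :=
  RingQuot (Cl.Rel R)

/-- The generators `Γ_k` of `Cℓ(A)`. -/
def Cl.gen {n : ℕ} (R : Submodule ℂ (Matrix (Fin n) (Fin n) ℂ)) (k : Fin n) : Cl R :=
  RingQuot.mkAlgHom ℂ (Cl.Rel R) (FreeAlgebra.ι ℂ k)

/-- The span of the generators `Γ_k`; `filt (Cl.genSpan R) q` is the space `F^q(Cℓ(A))` of the
elements of degree at most `q` in the `Γ`'s. -/
def Cl.genSpan {n : ℕ} (R : Submodule ℂ (Matrix (Fin n) (Fin n) ℂ)) : Submodule ℂ (Cl R) :=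
  Submodule.span ℂ (Set.range (Cl.gen R))

theorem Cl.gen_mem {n : ℕ} (R : Submodule ℂ (Matrix (Fin n) (Fin n) ℂ)) (k : Fin n) :
    Cl.gen R k ∈ filt (Cl.genSpan R) 1 :=
  mem_filt_one _ (Submodule.subset_span ⟨k, rfl⟩)

/-- The associated graded algebra `gr(Cℓ(A)) = ⨁_p F^p / F^{p-1}`. -/
abbrev GrCl {n : ℕ} (R : Submodule ℂ (Matrix (Fin n) (Fin n) ℂ)) : Type :=
  DirectSum ℕ (Gr (Cl.genSpan R))

/-- The class of `Γ_k` in `F^1 / F^0`, as an element of `gr(Cℓ(A))`. -/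
def GrCl.gen {n : ℕ} (R : Submodule ℂ (Matrix (Fin n) (Fin n) ℂ)) (k : Fin n) : GrCl R :=
  DirectSum.of (Gr (Cl.genSpan R)) 1 (Gr.cls _ 1 (Cl.gen R k) (Cl.gen_mem R k))

theorem Cl.relation {n : ℕ} (R : Submodule ℂ (Matrix (Fin n) (Fin n) ℂ))
    {ω : Matrix (Fin n) (Fin n) ℂ} (hω : ω ∈ perp R) :
    ∑ k, ∑ l, ω k l • (Cl.gen R k * Cl.gen R l) = algebraMap ℂ (Cl R) (∑ i, ω i i) := by
  have h := RingQuot.mkAlgHom_rel ℂ (s := Cl.Rel R) ⟨ω, hω, rfl, rfl⟩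
  rw [AlgHom.commutes] at h
  rw [← h]
  simp only [quad, map_sum, map_smul, map_mul]
  rfl

theorem GrCl.relation {n : ℕ} (R : Submodule ℂ (Matrix (Fin n) (Fin n) ℂ))
    {ω : Matrix (Fin n) (Fin n) ℂ} (hω : ω ∈ perp R) :
    ∑ k, ∑ l, ω k l • (GrCl.gen R k * GrCl.gen R l) = 0 := by
  have hkl : ∀ k l, Cl.gen R k * Cl.gen R l ∈ filt (Cl.genSpan R) 2 := fun k l =>
    filt_mul_mem _ (Cl.gen_mem R k) (Cl.gen_mem R l)
  have h1 : ∀ k l, ω k l • (GrCl.gen R k * GrCl.gen R l) =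
      DirectSum.lof ℂ ℕ (Gr (Cl.genSpan R)) 2
        (Gr.mkQ _ 2 (ω k l • ⟨Cl.gen R k * Cl.gen R l, hkl k l⟩)) := fun k l => by
    rw [map_smul, map_smul]
    congr 1
    exact DirectSum.of_mul_of _ _
  simp only [h1, ← map_sum]
  have h2 : Gr.mkQ (Cl.genSpan R) 2
      (∑ k, ∑ l, ω k l • ⟨Cl.gen R k * Cl.gen R l, hkl k l⟩) = 0 := by
    refine (Submodule.Quotient.mk_eq_zero _).2 ?_
    rw [Submodule.submoduleOf, Submodule.mem_comap, Submodule.subtype_apply]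
    simp only [AddSubmonoidClass.coe_finsetSum, Submodule.coe_smul]
    rw [Cl.relation R hω]
    exact algebraMap_mem_filt_one _ _
  rw [h2, map_zero]

/-- The canonical homomorphism `can : A^! → gr(Cℓ(A))`, which sends `θ_k` to the class of `Γ_k` in
`F^1 / F^0`. -/
def can {n : ℕ} (R : Submodule ℂ (Matrix (Fin n) (Fin n) ℂ)) : KoszulDual R →ₐ[ℂ] GrCl R :=
  RingQuot.liftAlgHom ℂ ⟨FreeAlgebra.lift ℂ (GrCl.gen R), by
    rintro a b ⟨ω, hω, rfl, rfl⟩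
    simp only [quad, map_sum, map_smul, map_mul, FreeAlgebra.lift_ι_apply, map_zero]
    exact GrCl.relation R hω⟩

theorem can_gen {n : ℕ} (R : Submodule ℂ (Matrix (Fin n) (Fin n) ℂ)) (k : Fin n) :
    can R (QAlg.gen (perp R) k) = GrCl.gen R k := by
  simp [can, QAlg.gen]

end NCEuclid

end

/-! Surjectivity of `can` is clear, since classes of words span the graded algebra. Injectivity is
proved dually: every linear form on `A^!`, restricted to degree `p`, must come from a form on
`Cℓ(A)` that vanishes on `F^{p-1}` (`exists_form_filtPrev`).

Because `R^{⊥⊥} = R`, a form on `Cℓ(A)` is a function `T` on words such that, for all words `u`,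
`v`, the matrix `T(u··v) - T(uv)·1` lies in `R` (`Cl.exists_form`). Such a `T` is built length by
length. To pass from length `m` to `m + 2`, one needs `S` congruent to a prescribed tensor modulo
each `R_i = E^{⊗i} ⊗ R ⊗ E^{⊗(m-i)}`. These congruences are solved from the last position to the
first. At position `j` the remaining defect must be written as an element of `R_j` plus one of
`⋂_{i>j} R_i`, which can be subtracted without harm to later positions.

The image of the defect in `A_2 ⊗ E^{⊗k}` is a Koszul cycle: it is a chain by the congruences
already solved, and its boundary is a combination of commutators of `∑ (x^k)^2` with the generators,
zero by centrality. Exactness makes it a boundary `b g`, and the part of `g` in `A_1` is the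
required correction (`IsKoszul.exists_decomposition`, `exists_defect_decomposition`).

For the dimensions, words forming a basis of `A^!` form a basis of `Cℓ(A)`, by comparing leading
terms. -/

namespace NCEuclid

/-! ### Linear forms on quotients of the free algebra, as functions on words -/

/-- The word `x^{i_1} ⋯ x^{i_m}` in the free algebra. -/
noncomputable def word {n : ℕ} (l : List (Fin n)) : Free n := (l.map (FreeAlgebra.ι ℂ)).prod

theorem word_append {n : ℕ} (u v : List (Fin n)) : word (u ++ v) = word u * word v := by
  simp [word]

theorem basisFreeMonoid_eq_word {n : ℕ} (l : FreeMonoid (Fin n)) :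
    FreeAlgebra.basisFreeMonoid ℂ (Fin n) l = word l.toList := by
  induction l using FreeMonoid.inductionOn' with
  | one => simp [FreeAlgebra.basisFreeMonoid, FreeAlgebra.equivMonoidAlgebraFreeMonoid, word]
  | of_mul a l ih =>
    simp [FreeAlgebra.basisFreeMonoid, FreeAlgebra.equivMonoidAlgebraFreeMonoid, word,
      FreeMonoid.lift_apply] at ih ⊢

theorem span_word (n : ℕ) : Submodule.span ℂ (Set.range (word (n := n))) = ⊤ := by
  rw [← (FreeAlgebra.basisFreeMonoid ℂ (Fin n)).span_eq]
  congr 2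
  exact (funext basisFreeMonoid_eq_word).symm

/-- A function on words determines a linear form on the free algebra. -/
theorem exists_form_word {n : ℕ} (t : List (Fin n) → ℂ) :
    ∃ φ : Free n →ₗ[ℂ] ℂ, ∀ l, φ (word l) = t l :=
  ⟨(FreeAlgebra.basisFreeMonoid ℂ (Fin n)).constr ℂ t, fun l => by
    have h := (FreeAlgebra.basisFreeMonoid ℂ (Fin n)).constr_basis ℂ t (FreeMonoid.ofList l)
    rwa [basisFreeMonoid_eq_word] at h⟩

/-- A linear form on a free algebra which is compatible with the two-sided multiples of the
relations `s` descends to the quotient by `s`. -/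
theorem exists_form_ringQuot {n : ℕ} {s : Free n → Free n → Prop} (φ : Free n →ₗ[ℂ] ℂ)
    (h : ∀ x y, s x y → ∀ u v : List (Fin n),
      φ (word u * x * word v) = φ (word u * y * word v)) :
    ∃ ψ : RingQuot s →ₗ[ℂ] ℂ, ∀ x, ψ (RingQuot.mkAlgHom ℂ s x) = φ x := by
  have h1 : ∀ x y, s x y → ∀ u v : Free n, φ (u * x * v) = φ (u * y * v) := by
    intro x y hxy u v
    have hu : u ∈ Submodule.span ℂ (Set.range (word (n := n))) := by simp [span_word]
    have hv : v ∈ Submodule.span ℂ (Set.range (word (n := n))) := by simp [span_word]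
    induction hu using Submodule.span_induction with
    | zero => simp
    | add a b _ _ ha hb => simp only [add_mul, map_add, ha, hb]
    | smul c a _ ha => simp only [smul_mul_assoc, map_smul, ha]
    | mem a ha =>
      obtain ⟨a, rfl⟩ := ha
      induction hv using Submodule.span_induction with
      | zero => simp
      | add a b _ _ ha hb => simp only [mul_add, map_add, ha, hb]
      | smul c a _ ha => simp only [mul_smul_comm, map_smul, ha]
      | mem b hb =>
        obtain ⟨b, rfl⟩ := hb
        exact h x y hxy a b
  -- Keeping `u` and `v` universally quantified is what lets the induction absorb the
  -- multiplications that generate `RingQuot.Rel`.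
  have h2 : ∀ x y, RingQuot.Rel s x y → ∀ u v : Free n, φ (u * x * v) = φ (u * y * v) := by
    intro x y hxy
    induction hxy with
    | of hxy => exact h1 _ _ hxy
    | add_left _ ih => intro u v; simp only [mul_add, add_mul, map_add, ih]
    | @mul_left a b c _ ih => intro u v; simpa only [mul_assoc] using ih u (c * v)
    | @mul_right a b c _ ih => intro u v; simpa only [mul_assoc] using ih (u * a) v
  have h3 : ∀ x y, RingQuot.mkAlgHom ℂ s x = RingQuot.mkAlgHom ℂ s y → φ x = φ y := by
    intro x y hxy
    rw [RingQuot.mkAlgHom_def] at hxy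
    simp only [RingQuot.mkRingHom_def] at hxy
    have h4 : Relation.EqvGen (RingQuot.Rel s) x y :=
      Quot.eqvGen_exact (congrArg RingQuot.toQuot hxy)
    clear hxy
    induction h4 with
    | rel x y hxy => simpa using h2 x y hxy 1 1
    | refl => rfl
    | symm _ _ _ ih => exact ih.symm
    | trans _ _ _ _ _ ih ih' => exact ih.trans ih'
  obtain ⟨g, hg⟩ := LinearMap.exists_rightInverse_of_surjective
    (RingQuot.mkAlgHom ℂ s).toLinearMap
    (LinearMap.range_eq_top.2 (RingQuot.mkAlgHom_surjective ℂ s))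
  exact ⟨φ ∘ₗ g, fun x => h3 _ _ (LinearMap.congr_fun hg _)⟩

theorem word_mul_quad_mul_word {n : ℕ} (u v : List (Fin n)) (r : Matrix (Fin n) (Fin n) ℂ) :
    word u * quad r * word v = ∑ k, ∑ l, r k l • word (u ++ k :: l :: v) := by
  simp only [quad, Finset.mul_sum, Finset.sum_mul, mul_smul_comm, smul_mul_assoc]
  simp [word, mul_assoc]

/-! ### Words, forms and biduality for `A` and `Cℓ(A)` -/

section Quadratic

variable {n : ℕ} (R : Submodule ℂ (Matrix (Fin n) (Fin n) ℂ))

/-- The word `x^{i_1} ⋯ x^{i_m}` in a quadratic algebra. -/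
noncomputable def QAlg.word (l : List (Fin n)) : QAlg R := (l.map (QAlg.gen R)).prod

/-- The word `Γ_{i_1} ⋯ Γ_{i_m}` in the generalized Clifford algebra. -/
noncomputable def Cl.word (l : List (Fin n)) : Cl R := (l.map (Cl.gen R)).prod

theorem QAlg.mk_word (l : List (Fin n)) :
    RingQuot.mkAlgHom ℂ (QAlg.Rel R) (NCEuclid.word l) = QAlg.word R l := by
  simp only [NCEuclid.word, QAlg.word, map_list_prod, List.map_map]
  rfl

theorem Cl.mk_word (l : List (Fin n)) :
    RingQuot.mkAlgHom ℂ (Cl.Rel R) (NCEuclid.word l) = Cl.word R l := by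
  simp only [NCEuclid.word, Cl.word, map_list_prod, List.map_map]
  rfl

theorem QAlg.span_word : Submodule.span ℂ (Set.range (QAlg.word R)) = ⊤ := by
  have h := congrArg (Submodule.map (RingQuot.mkAlgHom ℂ (QAlg.Rel R)).toLinearMap)
    (NCEuclid.span_word n)
  rw [Submodule.map_span, ← Set.range_comp, Submodule.map_top,
    LinearMap.range_eq_top.2 (RingQuot.mkAlgHom_surjective ℂ (QAlg.Rel R))] at h
  rw [← h]
  congr 2
  exact funext fun l => (QAlg.mk_word R l).symm

theorem Cl.span_word : Submodule.span ℂ (Set.range (Cl.word R)) = ⊤ := by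
  have h := congrArg (Submodule.map (RingQuot.mkAlgHom ℂ (Cl.Rel R)).toLinearMap)
    (NCEuclid.span_word n)
  rw [Submodule.map_span, ← Set.range_comp, Submodule.map_top,
    LinearMap.range_eq_top.2 (RingQuot.mkAlgHom_surjective ℂ (Cl.Rel R))] at h
  rw [← h]
  congr 2
  exact funext fun l => (Cl.mk_word R l).symm

variable {R}

/-- Linear forms on a quadratic algebra, as functions on words. -/
theorem QAlg.exists_form (t : List (Fin n) → ℂ)
    (ht : ∀ r ∈ R, ∀ u v, ∑ k, ∑ l, r k l * t (u ++ k :: l :: v) = 0) :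
    ∃ ψ : QAlg R →ₗ[ℂ] ℂ, ∀ l, ψ (QAlg.word R l) = t l := by
  obtain ⟨φ, hφ⟩ := exists_form_word t
  obtain ⟨ψ, hψ⟩ := exists_form_ringQuot (s := QAlg.Rel R) φ (by
    rintro _ _ ⟨r, hr, rfl, rfl⟩ u v
    simp [word_mul_quad_mul_word, hφ, ht r hr])
  exact ⟨ψ, fun l => by rw [← QAlg.mk_word, hψ, hφ]⟩

/-- Linear forms on the generalized Clifford algebra, as functions on words. -/
theorem Cl.exists_form (t : List (Fin n) → ℂ)
    (ht : ∀ ω ∈ perp R, ∀ u v,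
      ∑ k, ∑ l, ω k l * t (u ++ k :: l :: v) = (∑ i, ω i i) * t (u ++ v)) :
    ∃ ψ : Cl R →ₗ[ℂ] ℂ, ∀ l, ψ (Cl.word R l) = t l := by
  obtain ⟨φ, hφ⟩ := exists_form_word t
  obtain ⟨ψ, hψ⟩ := exists_form_ringQuot (s := Cl.Rel R) φ (by
    rintro _ _ ⟨r, hr, rfl, rfl⟩ u v
    rw [Algebra.algebraMap_eq_smul_one, mul_smul_comm, mul_one, smul_mul_assoc, ← word_append]
    simp [word_mul_quad_mul_word, hφ, ht r hr])
  exact ⟨ψ, fun l => by rw [← Cl.mk_word, hψ, hφ]⟩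

theorem QAlg.relation {r : Matrix (Fin n) (Fin n) ℂ} (hr : r ∈ R) :
    ∑ k, ∑ l, r k l • (QAlg.gen R k * QAlg.gen R l) = 0 := by
  have h := RingQuot.mkAlgHom_rel ℂ (s := QAlg.Rel R) ⟨r, hr, rfl, rfl⟩
  rw [map_zero] at h
  rw [← h]
  simp only [quad, map_sum, map_smul, map_mul]
  rfl

theorem QAlg.word_relation {r : Matrix (Fin n) (Fin n) ℂ} (hr : r ∈ R) (u v : List (Fin n)) :
    ∑ k, ∑ l, r k l • QAlg.word R (u ++ k :: l :: v) = 0 := by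
  have h := congrArg (fun x => QAlg.word R u * x * QAlg.word R v) (QAlg.relation hr)
  simp only [Finset.mul_sum, Finset.sum_mul, mul_smul_comm, smul_mul_assoc, mul_zero,
    zero_mul] at h
  rw [← h]
  simp [QAlg.word, mul_assoc]

/-- `R^{⊥⊥} ⊆ R`. -/
theorem mem_of_forall_perp {M : Matrix (Fin n) (Fin n) ℂ}
    (h : ∀ ω ∈ perp R, ∑ k, ∑ l, ω k l * M k l = 0) : M ∈ R := by
  by_contra hM
  -- The values on matrix units of a form separating `M` from `R` are the entries of an `ω ∈ R^⊥`
  -- that does not annihilate `M`.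
  obtain ⟨φ, hφ, hR⟩ := Submodule.exists_le_ker_of_notMem hM
  have key : ∀ N : Matrix (Fin n) (Fin n) ℂ,
      ∑ k, ∑ l, φ (Matrix.single k l 1) * N k l = φ N := by
    intro N
    conv_rhs => rw [Matrix.matrix_eq_sum_single N]
    simp only [map_sum]
    refine Finset.sum_congr rfl fun k _ => Finset.sum_congr rfl fun l _ => ?_
    rw [mul_comm, ← smul_eq_mul, ← map_smul, Matrix.smul_single, smul_eq_mul, mul_one]
  refine hφ ((key M).symm.trans (h (Matrix.of fun k l => φ (Matrix.single k l 1)) ?_))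
  exact fun r hr => (key r).trans (hR hr)

end Quadratic

/-! ### Koszul chains in terms of functions on words -/

section Slots

variable {n : ℕ}

/-- The matrix formed by the two letters between the words `p` and `q`. -/
def slot (t : List (Fin n) → ℂ) (p q : List (Fin n)) : Matrix (Fin n) (Fin n) ℂ :=
  Matrix.of fun k l => t (p ++ k :: l :: q)

theorem ofFn_update_update {m i : ℕ} (hi : i + 1 < m) (I : Fin m → Fin n) (k l : Fin n) :
    List.ofFn (Function.update (Function.update I ⟨i, Nat.lt_of_succ_lt hi⟩ k) ⟨i + 1, hi⟩ l) =
      (List.ofFn I).take i ++ k :: l :: (List.ofFn I).drop (i + 2) := by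
  apply List.ext_getElem
  · simp; omega
  intro j h1 h2
  rw [List.getElem_ofFn, List.getElem_append]
  simp only [Function.update_apply, Fin.mk.injEq, List.length_take, List.length_ofFn]
  split_ifs with h3 h4 h5 h6
  · omega
  · obtain rfl : j = i + 1 := h3
    have : i + 1 - min i m = 1 := by omega
    simp [this]
  · omega
  · obtain rfl : j = i := h5
    have : j - min j m = 0 := by omega
    simp [this]
  · simp
  · obtain ⟨d, rfl⟩ : ∃ d, j = i + 2 + d := ⟨j - (i + 2), by omega⟩
    have : i + 2 + d - min i m = d + 2 := by omega
    simp [this]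

variable {R : Submodule ℂ (Matrix (Fin n) (Fin n) ℂ)}

theorem ofFn_mem_koszulSpace_iff {m : ℕ} (t : List (Fin n) → ℂ) :
    (fun I => t (List.ofFn I)) ∈ koszulSpace R m ↔
      ∀ p q : List (Fin n), p.length + q.length + 2 = m → slot t p q ∈ R := by
  constructor
  · intro h p q hpq
    -- Without letters, `p` and `q` cannot be completed to a word of length `m`, but the only matrix
    -- is then zero.
    rcases isEmpty_or_nonempty (Fin n) with hn | ⟨⟨k⟩⟩
    · rw [Subsingleton.elim (slot t p q) 0]
      exact R.zero_mem
    · obtain ⟨I, hI⟩ : ∃ I : Fin m → Fin n, List.ofFn I = p ++ k :: k :: q := by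
        have hm : (p ++ k :: k :: q).length = m := by simp; omega
        subst hm
        exact ⟨_, List.ofFn_get _⟩
      have h1 := h p.length (by omega) I
      simp only [ofFn_update_update, hI] at h1
      have h2 : (p ++ k :: k :: q).drop (p.length + 2) = q := by
        rw [List.drop_append, List.drop_eq_nil_of_le] <;> simp
      simpa [slot, h2] using h1
  · intro h i hi I
    simp only [ofFn_update_update]
    exact h _ _ (by simp; omega)

theorem koszulSpace_add {m : ℕ} {s t : (Fin m → Fin n) → ℂ} (hs : s ∈ koszulSpace R m)
    (ht : t ∈ koszulSpace R m) : s + t ∈ koszulSpace R m :=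
  fun i hi I => R.add_mem (hs i hi I) (ht i hi I)

theorem koszulSpace_smul {m : ℕ} (c : ℂ) {t : (Fin m → Fin n) → ℂ}
    (ht : t ∈ koszulSpace R m) : c • t ∈ koszulSpace R m :=
  fun i hi I => R.smul_mem c (ht i hi I)

/-- The coefficients of a Koszul chain with respect to a linear form on the algebra. -/
theorem form_comp_mem_koszulSpace {m : ℕ} {f : (Fin m → Fin n) → QAlg R}
    (hf : f ∈ koszulChains R m) (ψ : QAlg R →ₗ[ℂ] ℂ) : (fun I => ψ (f I)) ∈ koszulSpace R m := by
  induction hf using Submodule.span_induction with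
  | zero => 
    simp only [Pi.zero_apply, map_zero]
    exact fun i hi I => R.zero_mem
  | add a b _ _ ha hb =>
    simp only [Pi.add_apply, map_add]
    exact koszulSpace_add ha hb
  | smul c a _ ha =>
    simp only [Pi.smul_apply, map_smul]
    exact koszulSpace_smul c ha
  | mem a ha =>
    obtain ⟨a, t, ht, rfl⟩ := ha
    simp only [map_smul, smul_eq_mul, mul_comm _ (ψ a)]
    exact koszulSpace_smul (ψ a) ht

/-- As `f` has finitely many values, only finitely many vectors of a basis of `A` occur in it.
Expanding along them writes `f` as a sum of elementary chains, whose coefficient arrays are those of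
the coordinate forms. -/
theorem mem_koszulChains {m : ℕ} {f : (Fin m → Fin n) → QAlg R}
    (hf : ∀ ψ : QAlg R →ₗ[ℂ] ℂ, (fun I => ψ (f I)) ∈ koszulSpace R m) :
    f ∈ koszulChains R m := by
  classical
  let b := Module.Basis.ofVectorSpace ℂ (QAlg R)
  let s : Finset _ := Finset.univ.biUnion fun I => (b.repr (f I)).support
  have h : f = ∑ j ∈ s, fun I => b.coord j (f I) • b j := by
    funext I
    conv_lhs => rw [← b.linearCombination_repr (f I), Finsupp.linearCombination_apply,
      Finsupp.sum]
    rw [Finset.sum_apply]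
    refine Finset.sum_subset (fun j hj => Finset.mem_biUnion.2 ⟨I, Finset.mem_univ _, hj⟩) ?_
    intro j _ hj
    simp [Finsupp.notMem_support_iff.1 hj]
  rw [h]
  exact Submodule.sum_mem _ fun j _ => Submodule.subset_span ⟨b j, _, hf (b.coord j), rfl⟩

/-- The linear form picking the coefficient of `x^a`. -/
theorem QAlg.exists_coeff_one (a : Fin n) :
    ∃ ψ : QAlg R →ₗ[ℂ] ℂ, ∀ l, ψ (QAlg.word R l) = if l = [a] then 1 else 0 := by
  refine QAlg.exists_form _ fun r _ u v => ?_
  refine Finset.sum_eq_zero fun k _ => Finset.sum_eq_zero fun l _ => ?_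
  rw [if_neg, mul_zero]
  intro h
  have := congrArg List.length h
  simp at this
  omega

/-- The linear form on the degree two component defined by an element of `R^⊥`. -/
theorem QAlg.exists_coeff_two {ω : Matrix (Fin n) (Fin n) ℂ} (hω : ω ∈ perp R) :
    ∃ ψ : QAlg R →ₗ[ℂ] ℂ, ∀ l, ψ (QAlg.word R l) =
      ∑ a, ∑ b, if l = [a, b] then ω a b else 0 := by
  refine QAlg.exists_form _ fun r hr u v => ?_
  rcases u with _ | ⟨c, u⟩
  · rcases v with _ | ⟨d, v⟩
    · refine Eq.trans ?_ (hω r hr)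
      refine Finset.sum_congr rfl fun k _ => Finset.sum_congr rfl fun l _ => ?_
      rw [mul_comm, Finset.sum_eq_single k, Finset.sum_eq_single l]
      · simp
      all_goals
        intros
        simp_all [eq_comm]
    · simp
  · rcases u with _ | ⟨d, u⟩ <;> simp

/-! ### Exactness as a decomposition statement -/

/-- Exactness of the Koszul complex in `A_2 ⊗ A^{!*}_k`, in terms of the spaces
`R_i = E^{⊗i} ⊗ R ⊗ E^{⊗(k-i)}`: it gives `⋂_{i>0} (R_0 + R_i) ⊆ R_0 + ⋂_{i>0} R_i`. -/
theorem IsKoszul.exists_decomposition (hK : IsKoszul R) (k : ℕ) (D : List (Fin n) → ℂ)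
    (f : List (Fin n) → QAlg R)
    (hf : ∀ w, f w = ∑ a, ∑ b, D (a :: b :: w) • (QAlg.gen R a * QAlg.gen R b))
    (hspace : ∀ (ψ : QAlg R →ₗ[ℂ] ℂ) (p q : List (Fin n)), p.length + q.length + 2 = k →
      slot (fun w => ψ (f w)) p q ∈ R)
    (hcycle : ∀ q : List (Fin n), q.length + 1 = k → ∑ c, f (c :: q) * QAlg.gen R c = 0) :
    ∃ t : List (Fin n) → ℂ,
      (∀ p q : List (Fin n), p ≠ [] → p.length + q.length = k → slot t p q ∈ R) ∧
      ∀ w : List (Fin n), w.length = k → slot D [] w - slot t [] w ∈ R := by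
  -- For `k = 0`, where exactness is not assumed, `t = D` works: no nonempty prefix is possible.
  rcases k with _ | m
  · refine ⟨D, fun p q hp hpq => ?_, fun w _ => by simp⟩
    exact absurd (List.eq_nil_of_length_eq_zero (by omega)) hp
  have hchain : (fun I => f (List.ofFn I)) ∈ koszulChains R (m + 1) :=
    mem_koszulChains fun ψ => (ofFn_mem_koszulSpace_iff fun w => ψ (f w)).2 (hspace ψ)
  have hB : koszulB R m (fun I => f (List.ofFn I)) = 0 := by
    funext I
    simp only [koszulB, List.ofFn_cons]
    exact hcycle _ (by simp)
  obtain ⟨g, hg, hgf⟩ := hK m _ hchain hB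
  choose ψ hψ using QAlg.exists_coeff_one (R := R)
  have hinj : Function.Injective (List.ofFn : (Fin (m + 2) → Fin n) → List (Fin n)) :=
    List.ofFn_injective
  -- `T a` holds the coefficients of `x^a` in the values of `g`, so `t` is the component of `g` in
  -- `E ⊗ A^{!*}_{m+2}`. The default values `0` are never used.
  let T : Fin n → List (Fin n) → ℂ := fun a => Function.extend List.ofFn (fun I => ψ a (g I)) 0
  have hT : ∀ a I, T a (List.ofFn I) = ψ a (g I) := fun a I => hinj.extend_apply _ _ _
  let t : List (Fin n) → ℂ
    | [] => 0
    | a :: w => T a w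
  refine ⟨t, ?_, ?_⟩
  · rintro (_ | ⟨a, p⟩) q hp hpq
    · exact absurd rfl hp
    · refine (ofFn_mem_koszulSpace_iff (m := m + 2) (T a)).1 ?_ p q (by simp at hpq; omega)
      simpa only [hT] using form_comp_mem_koszulSpace hg (ψ a)
  · intro w hw
    refine mem_of_forall_perp fun ω hω => ?_
    obtain ⟨χ, hχ⟩ := QAlg.exists_coeff_two hω
    have hχ2 : ∀ a b, χ (QAlg.gen R a * QAlg.gen R b) = ω a b := by
      intro a b
      have h := hχ [a, b]
      rw [Finset.sum_eq_single a, Finset.sum_eq_single b] at h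
      · simpa [QAlg.word] using h
      all_goals simp +contextual [eq_comm]
    -- `χ` sees only degree two, so only the degree-one part of `g` contributes to `χ (b g)`.
    have hχψ : ∀ y b, χ (y * QAlg.gen R b) = ∑ a, ω a b * ψ a y := by
      intro y b
      have hy : y ∈ Submodule.span ℂ (Set.range (QAlg.word R)) := by simp [QAlg.span_word]
      induction hy using Submodule.span_induction with
      | zero => simp
      | add x y _ _ hx hy => simp only [add_mul, map_add, hx, hy, mul_add, Finset.sum_add_distrib]
      | smul c x _ hx =>
        simp only [smul_mul_assoc, map_smul, hx, smul_eq_mul, Finset.mul_sum, mul_left_comm]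
      | mem x hx =>
        obtain ⟨l, rfl⟩ := hx
        have h1 : QAlg.word R l * QAlg.gen R b = QAlg.word R (l ++ [b]) := by simp [QAlg.word]
        rw [h1, hχ]
        refine Finset.sum_congr rfl fun a _ => ?_
        rw [hψ]
        have h2 : ∀ c, l ++ [b] = [a, c] ↔ l = [a] ∧ b = c := fun c => by
          rw [show [a, c] = [a] ++ [c] from rfl, ← List.concat_eq_append, ← List.concat_eq_append,
            List.concat_inj]
        simp only [h2, ite_and]
        split_ifs <;> simp
    obtain ⟨I, rfl⟩ : ∃ I : Fin (m + 1) → Fin n, List.ofFn I = w := by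
      rw [← hw]
      exact ⟨_, List.ofFn_get _⟩
    have hl : χ (f (List.ofFn I)) = ∑ a, ∑ b, ω a b * D (a :: b :: List.ofFn I) := by
      simp only [hf, map_sum, map_smul, hχ2, smul_eq_mul, mul_comm]
    have hr : χ (koszulB R (m + 1) g I) = ∑ a, ∑ b, ω a b * t (a :: b :: List.ofFn I) := by
      simp only [koszulB, map_sum, hχψ, ← hT, List.ofFn_cons]
      rw [Finset.sum_comm]
    simp only [Matrix.sub_apply, mul_sub, Finset.sum_sub_distrib]
    rw [sub_eq_zero]
    exact hl.symm.trans ((congrArg χ (congrFun hgf I)).symm.trans hr)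

end Slots

/-! ### Extending Clifford forms to longer words -/

section Extension

variable {n : ℕ} {R : Submodule ℂ (Matrix (Fin n) (Fin n) ℂ)}

/-- A function on words satisfies the relations of the generalized Clifford algebra for words of
length at most `N`. -/
def IsCliffordForm (R : Submodule ℂ (Matrix (Fin n) (Fin n) ℂ)) (N : ℕ)
    (T : List (Fin n) → ℂ) : Prop :=
  ∀ u v : List (Fin n), u.length + v.length + 2 ≤ N → slot T u v - T (u ++ v) • 1 ∈ R

/-- `ω` annihilates `R` and pairs with the identity matrix to its trace. -/
theorem sum_mul_slot {ω : Matrix (Fin n) (Fin n) ℂ} (hω : ω ∈ perp R) {T : List (Fin n) → ℂ}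
    {u v : List (Fin n)} {c : ℂ} (h : slot T u v - c • 1 ∈ R) :
    ∑ a, ∑ b, ω a b * T (u ++ a :: b :: v) = (∑ i, ω i i) * c := by
  have h1 := hω _ h
  simp only [Matrix.sub_apply, mul_sub, Finset.sum_sub_distrib, sub_eq_zero] at h1
  refine h1.trans ?_
  simp [Matrix.one_apply, Finset.sum_mul]

/-- An element of `R` is a relation of `A`, while the identity matrix becomes `∑ (x^k)^2`. This is
how the central element enters. -/
theorem sum_smul_slot {T : List (Fin n) → ℂ} {u v : List (Fin n)} {c : ℂ}
    (h : slot T u v - c • 1 ∈ R) :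
    ∑ a, ∑ b, T (u ++ a :: b :: v) • (QAlg.gen R a * QAlg.gen R b) =
      c • ∑ k, QAlg.gen R k ^ 2 := by
  have h1 := QAlg.relation h
  have h2 : ∑ a, ∑ b, T (u ++ a :: b :: v) • (QAlg.gen R a * QAlg.gen R b) =
      ∑ a, ∑ b, (slot T u v - c • 1) a b • (QAlg.gen R a * QAlg.gen R b) +
      ∑ a, ∑ b, (c • (1 : Matrix (Fin n) (Fin n) ℂ)) a b • (QAlg.gen R a * QAlg.gen R b) := by
    simp only [← Finset.sum_add_distrib, ← add_smul, Matrix.sub_apply, sub_add_cancel]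
    rfl
  rw [h2, h1, zero_add]
  simp [Matrix.one_apply, Finset.smul_sum, pow_two, ite_smul]

/-- Products of generators satisfy the relations `R`. Hence applying a form to the image of a tensor
in `A_2` is contracting it with an element of `R^⊥`. -/
theorem form_mul_mem_perp (ψ : QAlg R →ₗ[ℂ] ℂ) :
    (Matrix.of fun a b => ψ (QAlg.gen R a * QAlg.gen R b)) ∈ perp R := by
  intro r hr
  have h := congrArg ψ (QAlg.relation hr)
  simpa only [map_sum, map_smul, smul_eq_mul, map_zero, mul_comm, Matrix.of_apply] using h

/-- The failure at the prefix `u` of the relations of the generalized Clifford algebra, for a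
function `S` on words of length `m + 2` and a function `T` on words of length `m`. -/
def defect (S T : List (Fin n) → ℂ) (u : List (Fin n)) : List (Fin n) → ℂ
  | a :: b :: w => S (u ++ a :: b :: w) - (if a = b then 1 else 0) * T (u ++ w)
  | _ => 0

/-- The defect meets both requirements of `IsKoszul.exists_decomposition`. The chain condition
follows from the congruences for `S` beyond `u` and the relations of `T`; the cycle condition
follows from the congruence for `S` one position beyond `u` and centrality. The correction `t`
repairs position `u.length` and leaves the later ones intact. -/
theorem exists_defect_decomposition (hK : IsKoszul R)
    (hcentral : ∑ k, QAlg.gen R k ^ 2 ∈ Subalgebra.center ℂ (QAlg R))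
    {m d : ℕ} {S T : List (Fin n) → ℂ} (hT : IsCliffordForm R m T) {u : List (Fin n)}
    (hu : u.length + d = m)
    (hS : ∀ p q : List (Fin n), u.length < p.length → p.length + q.length = m →
      slot S p q - T (p ++ q) • 1 ∈ R) :
    ∃ t : List (Fin n) → ℂ,
      (∀ p q : List (Fin n), p ≠ [] → p.length + q.length = d → slot t p q ∈ R) ∧
      ∀ w : List (Fin n), w.length = d → slot (defect S T u) [] w - slot t [] w ∈ R := by
  refine hK.exists_decomposition d (defect S T u) _ (fun w => rfl) ?_ ?_
  · intro ψ p q hpq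
    obtain ⟨ω, hω, hψ⟩ : ∃ ω ∈ perp R, ∀ a b, ψ (QAlg.gen R a * QAlg.gen R b) = ω a b :=
      ⟨_, form_mul_mem_perp ψ, fun _ _ => rfl⟩
    have h1 : ∀ a b, slot S (u ++ a :: b :: p) q - T ((u ++ a :: b :: p) ++ q) • 1 ∈ R :=
      fun a b => hS _ _ (by simp) (by simp; omega)
    have h2 : slot T (u ++ p) q - T ((u ++ p) ++ q) • 1 ∈ R := hT _ _ (by simp; omega)
    have h3 := sum_mul_slot hω (hT u (p ++ q) (by simp; omega))
    -- The two identity-matrix terms on the right cancel by `h3`, the relation of `T` at `u`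
    -- contracted with `ω`.
    have h4 : slot (fun w => ψ (∑ a, ∑ b,
          defect S T u (a :: b :: w) • (QAlg.gen R a * QAlg.gen R b))) p q =
        (∑ a, ∑ b, ω a b • (slot S (u ++ a :: b :: p) q - T ((u ++ a :: b :: p) ++ q) • 1)) -
          (∑ i, ω i i) • (slot T (u ++ p) q - T ((u ++ p) ++ q) • 1) := by
      ext k l
      have h5 : ∑ a, ∑ b, ω a b * (if a = b then 1 else 0) = ∑ i, ω i i := by simp
      have h6 : ∀ (g : Fin n → Fin n → ℂ) (c : ℂ),
          ∑ a, ∑ b, (g a b - (if a = b then 1 else 0) * c) * ω a b =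
            ∑ a, ∑ b, ω a b * g a b - (∑ i, ω i i) * c := fun g c => by
        rw [← h5]
        simp only [Finset.sum_mul, ← Finset.sum_sub_distrib]
        exact Finset.sum_congr rfl fun a _ => Finset.sum_congr rfl fun b _ => by ring
      simp only [Matrix.sub_apply, Matrix.sum_apply, Matrix.smul_apply, slot, Matrix.of_apply,
        defect, map_sum, map_smul, hψ, smul_eq_mul, mul_sub, Finset.sum_sub_distrib, ← mul_assoc,
        ← Finset.sum_mul, List.append_assoc, List.cons_append]
      rw [h6, h3]
      ring
    rw [h4]
    exact R.sub_mem (R.sum_mem fun a _ => R.sum_mem fun b _ => R.smul_mem _ (h1 a b))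
      (R.smul_mem _ h2)
  · intro q hq
    have h1 : ∀ a, ∑ b, ∑ c, S (u ++ a :: b :: c :: q) • (QAlg.gen R b * QAlg.gen R c) =
        T (u ++ a :: q) • ∑ k, QAlg.gen R k ^ 2 := fun a => by
      have h := sum_smul_slot (hS (u ++ [a]) q (by simp) (by simp; omega))
      simpa only [List.append_assoc, List.cons_append, List.nil_append] using h
    have h2 : ∑ a, ∑ b, (if a = b then (1 : ℂ) else 0) • (QAlg.gen R a * QAlg.gen R b) =
        ∑ k, QAlg.gen R k ^ 2 := by simp [pow_two, ite_smul]
    have h3 : ∀ c, ∑ a, ∑ b, defect S T u (a :: b :: c :: q) • (QAlg.gen R a * QAlg.gen R b) =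
        ∑ a, ∑ b, S (u ++ a :: b :: c :: q) • (QAlg.gen R a * QAlg.gen R b) -
          T (u ++ c :: q) • ∑ k, QAlg.gen R k ^ 2 := fun c => by
      rw [eq_sub_iff_add_eq, ← h2]
      simp only [Finset.smul_sum, smul_smul, ← Finset.sum_add_distrib, ← add_smul]
      refine Finset.sum_congr rfl fun a _ => Finset.sum_congr rfl fun b _ => ?_
      congr 1
      simp only [defect]
      ring
    -- Reassociating `(x^a x^b) x^c` moves the contraction to the last two letters, where `h1`
    -- evaluates it. What remains is the sum of the `T(u a q)` times the commutators of `x^a` with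
    -- `∑ (x^k)^2`.
    have h4 : ∑ c, (∑ a, ∑ b, S (u ++ a :: b :: c :: q) • (QAlg.gen R a * QAlg.gen R b)) *
        QAlg.gen R c = ∑ a, QAlg.gen R a *
          ∑ b, ∑ c, S (u ++ a :: b :: c :: q) • (QAlg.gen R b * QAlg.gen R c) := by
      simp only [Finset.sum_mul, Finset.mul_sum, smul_mul_assoc, mul_smul_comm, mul_assoc]
      rw [Finset.sum_comm]
      exact Finset.sum_congr rfl fun a _ => Finset.sum_comm
    simp only [h3, sub_mul, Finset.sum_sub_distrib, h4, h1]
    rw [sub_eq_zero]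
    refine Finset.sum_congr rfl fun a _ => ?_
    rw [mul_smul_comm, smul_mul_assoc, Subalgebra.mem_center_iff.1 hcentral]

/-- One more layer of a linear form on the generalized Clifford algebra, with the relations
imposed at the positions `≥ j`. -/
theorem exists_partial_extension (hK : IsKoszul R)
    (hcentral : ∑ k, QAlg.gen R k ^ 2 ∈ Subalgebra.center ℂ (QAlg R))
    {m : ℕ} {T : List (Fin n) → ℂ} (hT : IsCliffordForm R m T) (d j : ℕ) (hj : j + d = m + 1) :
    ∃ S : List (Fin n) → ℂ, ∀ u v : List (Fin n), u.length + v.length = m → j ≤ u.length →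
      slot S u v - T (u ++ v) • 1 ∈ R := by
  induction d generalizing j with
  -- Here `j = m + 1` exceeds the length of every prefix, so there is no condition.
  | zero => exact ⟨0, fun u v _ _ => by omega⟩
  | succ d ih =>
    obtain ⟨S, hS⟩ := ih (j + 1) (by omega)
    have h : ∀ u : List (Fin n), ∃ t : List (Fin n) → ℂ, u.length = j →
        (∀ p q : List (Fin n), p ≠ [] → p.length + q.length = d → slot t p q ∈ R) ∧
        ∀ w : List (Fin n), w.length = d → slot (defect S T u) [] w - slot t [] w ∈ R := by
      intro u
      by_cases hu : u.length = j
      · obtain ⟨t, ht⟩ := exists_defect_decomposition hK hcentral hT (S := S) (u := u) (d := d)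
          (by omega) (fun p q hp hpq => hS p q hpq (by omega))
        exact ⟨t, fun _ => ht⟩
      · exact ⟨0, fun h => absurd h hu⟩
    choose t ht using h
    -- The corrections for different prefixes of length `j` act on disjoint sets of words, so all
    -- are subtracted at once.
    refine ⟨fun l => S l - t (l.take j) (l.drop j), fun u' v hm hju => ?_⟩
    obtain ⟨u, p, hu, rfl⟩ : ∃ u p : List (Fin n), u.length = j ∧ u' = u ++ p :=
      ⟨u'.take j, u'.drop j, by simpa using hju, (List.take_append_drop j u').symm⟩
    have h1 : slot (fun l => S l - t (l.take j) (l.drop j)) (u ++ p) v =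
        slot S (u ++ p) v - slot (t u) p v := by
      ext k l
      simp [slot, ← hu]
    rw [List.length_append] at hm
    obtain ⟨ht1, ht2⟩ := ht u hu
    rw [h1]
    by_cases hp : p = []
    · subst hp
      convert ht2 v (by simp at hm; omega) using 1
      ext k l
      simp [slot, defect, Matrix.one_apply]
      ring
    · have hp' : 0 < p.length := List.length_pos_iff.2 hp
      rw [sub_right_comm]
      exact R.sub_mem (hS _ _ (by simp; omega) (by simp; omega)) (ht1 p v hp (by omega))

/-- The new relations link words of length `N + 1` only to words of length `N - 1`. So `T` is kept
up to length `N`, and a solution `S` of all congruences is used on longer words. -/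
theorem IsCliffordForm.exists_succ (hK : IsKoszul R)
    (hcentral : ∑ k, QAlg.gen R k ^ 2 ∈ Subalgebra.center ℂ (QAlg R))
    {N : ℕ} {T : List (Fin n) → ℂ} (hT : IsCliffordForm R N T) :
    ∃ T' : List (Fin n) → ℂ, IsCliffordForm R (N + 1) T' ∧ ∀ l, l.length ≤ N → T' l = T l := by
  rcases N with _ | m
  -- A word of length at most one has no two adjacent letters, so nothing is imposed.
  · exact ⟨T, fun u v h => by omega, fun _ _ => rfl⟩
  have hTm : IsCliffordForm R m T := fun u v h => hT u v (by omega)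
  obtain ⟨S, hS⟩ := exists_partial_extension hK hcentral hTm (m + 1) 0 (by omega)
  refine ⟨fun l => if l.length ≤ m + 1 then T l else S l, fun u v h => ?_,
    fun l hl => if_pos hl⟩
  have h1 : (u ++ v).length ≤ m + 1 := by simp; omega
  beta_reduce
  rw [if_pos h1]
  rcases Nat.lt_or_ge (m + 1) (u.length + v.length + 2) with h2 | h2
  · convert hS u v (by omega) (Nat.zero_le _) using 2
    ext k l
    refine if_neg ?_
    simp
    omega
  · convert hT u v h2 using 2
    ext k l
    refine if_pos ?_
    simp
    omega

/-- Under the Koszul and centrality conditions, every function on words of length at most `N`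
satisfying the relations of the generalized Clifford algebra extends to a linear form on it. -/
theorem IsCliffordForm.exists_form (hK : IsKoszul R)
    (hcentral : ∑ k, QAlg.gen R k ^ 2 ∈ Subalgebra.center ℂ (QAlg R))
    {N : ℕ} {T : List (Fin n) → ℂ} (hT : IsCliffordForm R N T) :
    ∃ ψ : Cl R →ₗ[ℂ] ℂ, ∀ l, l.length ≤ N → ψ (Cl.word R l) = T l := by
  choose next hnext using fun (N : ℕ) (T : {T : List (Fin n) → ℂ // IsCliffordForm R N T}) =>
    T.2.exists_succ hK hcentral
  let seq : ∀ j : ℕ, {T : List (Fin n) → ℂ // IsCliffordForm R (N + j) T} := fun j =>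
    Nat.rec ⟨T, hT⟩ (fun j S => ⟨next (N + j) S, (hnext (N + j) S).1⟩) j
  have hstep : ∀ j l, l.length ≤ N + j → (seq (j + 1)).1 l = (seq j).1 l :=
    fun j l hl => (hnext (N + j) (seq j)).2 l hl
  have hstable : ∀ i j l, l.length ≤ N + j → (seq (j + i)).1 l = (seq j).1 l := by
    intro i j l hl
    induction i with
    | zero => rfl
    | succ i ih => exact (hstep (j + i) l (by omega)).trans ih
  have hlen : ∀ j l, l.length ≤ N + j → (seq l.length).1 l = (seq j).1 l := by
    intro j l hl
    rcases le_total j l.length with h | h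
    · obtain ⟨i, hi⟩ := Nat.exists_eq_add_of_le h
      rw [hi, hstable i j l hl]
    · obtain ⟨i, rfl⟩ := Nat.exists_eq_add_of_le h
      rw [hstable i l.length l (by omega)]
  -- The limit is a diagonal: the value at `l` no longer changes from stage `l.length` on.
  obtain ⟨ψ, hψ⟩ := Cl.exists_form (R := R) (fun l => (seq l.length).1 l) (by
    intro ω hω u v
    have h := (seq (u.length + v.length + 2)).2 u v (by omega)
    rw [hlen (u.length + v.length + 2) (u ++ v) (by simp; omega), ← sum_mul_slot hω h]
    refine Finset.sum_congr rfl fun k _ => Finset.sum_congr rfl fun l _ => ?_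
    rw [hlen (u.length + v.length + 2) (u ++ k :: l :: v) (by simp; omega)])
  exact ⟨ψ, fun l hl => (hψ l).trans (hlen 0 l hl)⟩

/-- A linear form on the Koszul dual, restricted to the words of length `p`, extends to a linear
form on the generalized Clifford algebra which vanishes on the words of smaller length. -/
theorem exists_form_of_koszulDual (hK : IsKoszul R)
    (hcentral : ∑ k, QAlg.gen R k ^ 2 ∈ Subalgebra.center ℂ (QAlg R)) (p : ℕ)
    (ξ : KoszulDual R →ₗ[ℂ] ℂ) :
    ∃ ψ : Cl R →ₗ[ℂ] ℂ, (∀ l : List (Fin n), l.length < p → ψ (Cl.word R l) = 0) ∧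
      ∀ l : List (Fin n), l.length = p → ψ (Cl.word R l) = ξ (QAlg.word (perp R) l) := by
  have hT : IsCliffordForm R p
      (fun l => if l.length = p then ξ (QAlg.word (perp R) l) else 0) := by
    intro u v h
    -- Since `u ++ v` has length at most `p - 2`, the trace term vanishes. What remains are the
    -- homogeneous relations `R^⊥`, which `ξ` respects.
    have h1 : (u ++ v).length ≠ p := by simp; omega
    beta_reduce
    rw [if_neg h1, zero_smul, sub_zero]
    refine mem_of_forall_perp fun ω hω => ?_
    by_cases h2 : u.length + v.length + 2 = p
    · have h3 := congrArg ξ (QAlg.word_relation hω u v)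
      simp only [map_sum, map_smul, map_zero, smul_eq_mul] at h3
      refine Eq.trans ?_ h3
      refine Finset.sum_congr rfl fun k _ => Finset.sum_congr rfl fun l _ => ?_
      congr 1
      refine if_pos ?_
      simp
      omega
    · refine Finset.sum_eq_zero fun k _ => Finset.sum_eq_zero fun l _ => ?_
      refine mul_eq_zero_of_right _ (if_neg ?_)
      simp
      omega
  obtain ⟨ψ, hψ⟩ := hT.exists_form hK hcentral
  exact ⟨ψ, fun l hl => (hψ l hl.le).trans (if_neg hl.ne),
    fun l hl => (hψ l hl.le).trans (if_pos hl)⟩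

end Extension

/-! ### Forms on the associated graded algebra -/

section Filtration

variable {B : Type} [Ring B] [Algebra ℂ B]

/-- A linear form vanishing on `F^{p-1}` induces a linear form on the component of degree `p` of
the associated graded algebra. -/
theorem Gr.exists_form (S : Submodule ℂ B) (p : ℕ) (ψ : B →ₗ[ℂ] ℂ)
    (hψ : ∀ a ∈ filtPrev S p, ψ a = 0) :
    ∃ χ : DirectSum ℕ (Gr S) →ₗ[ℂ] ℂ, ∀ (q : ℕ) (a : B) (ha : a ∈ filt S q),
      χ (DirectSum.lof ℂ ℕ (Gr S) q (Gr.cls S q a ha)) = if q = p then ψ a else 0 := by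
  have h : ∀ q, ∃ χ : Gr S q →ₗ[ℂ] ℂ, ∀ (a : B) (ha : a ∈ filt S q),
      χ (Gr.cls S q a ha) = if q = p then ψ a else 0 := by
    intro q
    by_cases hq : q = p
    · subst hq
      exact ⟨Submodule.liftQ _ (ψ ∘ₗ (filt S q).subtype) fun a ha => hψ _ ha,
        fun a ha => (if_pos rfl).symm⟩
    · exact ⟨0, fun a ha => (if_neg hq).symm⟩
  choose χ hχ using h
  exact ⟨DirectSum.toModule ℂ ℕ ℂ χ, fun q a ha => by rw [DirectSum.toModule_lof, hχ]⟩

end Filtration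

/-! ### Words in the filtration, and bijectivity of `can` -/

section Canonical

variable {n : ℕ} {R : Submodule ℂ (Matrix (Fin n) (Fin n) ℂ)}

theorem QAlg.exists_linearCombination_word (x : QAlg R) :
    ∃ c : List (Fin n) →₀ ℂ, Finsupp.linearCombination ℂ (QAlg.word R) c = x := by
  have hx : x ∈ Submodule.span ℂ (Set.range (QAlg.word R)) := by simp [QAlg.span_word]
  exact Finsupp.mem_span_range_iff_exists_finsupp.1 hx

theorem QAlg.comp_eq_span (p : ℕ) :
    QAlg.comp R p = Submodule.span ℂ (QAlg.word R '' {l | l.length = p}) := by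
  induction p with
  | zero =>
    rw [QAlg.comp, pow_zero, Submodule.one_eq_span]
    congr 1
    ext x
    simp [QAlg.word, List.length_eq_zero_iff]
  | succ p ih =>
    rw [QAlg.comp] at ih ⊢
    rw [pow_succ', ih, Submodule.span_mul_span]
    congr 1
    ext x
    rw [Set.mem_mul]
    constructor
    · rintro ⟨_, ⟨k, rfl⟩, _, ⟨l, hl, rfl⟩, rfl⟩
      exact ⟨k :: l, congrArg (· + 1) hl, by simp [QAlg.word]⟩
    · rintro ⟨_ | ⟨k, l⟩, hl, rfl⟩
      · simp at hl
      · exact ⟨_, ⟨k, rfl⟩, _, ⟨l, Nat.succ.inj hl, rfl⟩, by simp [QAlg.word]⟩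

theorem Cl.filt_eq_span (p : ℕ) :
    filt (Cl.genSpan R) p = Submodule.span ℂ (Cl.word R '' {l | l.length ≤ p}) := by
  induction p with
  | zero =>
    rw [filt, pow_zero, Submodule.one_eq_span]
    congr 1
    ext x
    simp [Cl.word, List.length_eq_zero_iff]
  | succ p ih =>
    rw [filt] at ih ⊢
    rw [pow_succ', ih, Cl.genSpan, Submodule.one_eq_span, ← Submodule.span_union,
      Submodule.span_mul_span]
    congr 1
    ext x
    rw [Set.mem_mul]
    constructor
    · rintro ⟨_, rfl | ⟨k, rfl⟩, _, ⟨l, hl, rfl⟩, rfl⟩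
      · exact ⟨l, Nat.le_succ_of_le hl, (one_mul _).symm⟩
      · exact ⟨k :: l, Nat.succ_le_succ hl, by simp [Cl.word]⟩
    · rintro ⟨_ | ⟨k, l⟩, hl, rfl⟩
      · exact ⟨1, Or.inl rfl, _, ⟨[], Nat.zero_le _, rfl⟩, one_mul _⟩
      · exact ⟨_, Or.inr ⟨k, rfl⟩, _, ⟨l, Nat.le_of_succ_le_succ hl, rfl⟩, by simp [Cl.word]⟩

theorem Cl.filtPrev_eq_span (p : ℕ) :
    filtPrev (Cl.genSpan R) p = Submodule.span ℂ (Cl.word R '' {l | l.length < p}) := by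
  cases p with
  | zero => simp [filtPrev]
  | succ p => simp only [filtPrev, Cl.filt_eq_span, Nat.lt_succ_iff]

theorem Cl.word_mem_filt {l : List (Fin n)} {p : ℕ} (h : l.length ≤ p) :
    Cl.word R l ∈ filt (Cl.genSpan R) p := by
  rw [Cl.filt_eq_span]
  exact Submodule.subset_span ⟨l, h, rfl⟩

theorem can_word (l : List (Fin n)) :
    can R (QAlg.word (perp R) l) = DirectSum.lof ℂ ℕ (Gr (Cl.genSpan R)) l.length
      (Gr.cls _ l.length (Cl.word R l) (Cl.word_mem_filt le_rfl)) := by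
  induction l with
  | nil => exact map_one _
  | cons k l ih =>
    have h : QAlg.word (perp R) (k :: l) = QAlg.gen (perp R) k * QAlg.word (perp R) l := by
      simp [QAlg.word]
    rw [h, map_mul, ih, can_gen]
    refine (DirectSum.of_mul_of _ _).trans ?_
    refine DirectSum.of_eq_of_gradedMonoid_eq (Gr.mk_cls_congr _ ?_ ?_ _ _)
    · simp [add_comm]
    · simp [Cl.word]

/-- `F^p` is spanned by words of length at most `p`, and the shorter ones vanish in `F^p / F^{p-1}`;
those of length `p` are images of words of `A^!`. -/
theorem map_comp_can (p : ℕ) : (QAlg.comp (perp R) p).map (can R).toLinearMap =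
    LinearMap.range (DirectSum.lof ℂ ℕ (Gr (Cl.genSpan R)) p) := by
  rw [QAlg.comp_eq_span, Submodule.map_span]
  apply le_antisymm
  · rw [Submodule.span_le]
    rintro _ ⟨_, ⟨l, rfl, rfl⟩, rfl⟩
    exact ⟨_, (can_word l).symm⟩
  · rintro _ ⟨x, rfl⟩
    obtain ⟨a, ha, rfl⟩ := Gr.exists_cls _ x
    have ha' := ha
    rw [Cl.filt_eq_span] at ha'
    induction ha' using Submodule.span_induction with
    | zero =>
      rw [(Gr.cls_eq_zero _ ha).2 (Submodule.zero_mem _), map_zero]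
      exact Submodule.zero_mem _
    | add a b ha1 hb1 iha ihb =>
      rw [← Cl.filt_eq_span] at ha1 hb1
      have h := Submodule.add_mem _ (iha ha1) (ihb hb1)
      rw [← map_add] at h
      exact h
    | smul c a ha1 iha =>
      rw [← Cl.filt_eq_span] at ha1
      have h := Submodule.smul_mem _ c (iha ha1)
      rw [← map_smul] at h
      exact h
    | mem a ha1 =>
      obtain ⟨l, hl, rfl⟩ := ha1
      rcases Nat.lt_or_ge l.length p with h | h
      · have h0 : Cl.word R l ∈ filtPrev (Cl.genSpan R) p := by
          rw [Cl.filtPrev_eq_span]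
          exact Submodule.subset_span ⟨l, h, rfl⟩
        rw [(Gr.cls_eq_zero _ ha).2 h0, map_zero]
        exact Submodule.zero_mem _
      · obtain rfl : l.length = p := le_antisymm hl h
        exact Submodule.subset_span ⟨_, ⟨l, rfl, rfl⟩, can_word l⟩

theorem can_surjective : Function.Surjective (can R) := by
  intro x
  induction x using DirectSum.induction_on with
  | zero => exact ⟨0, map_zero _⟩
  | of p x =>
    have h : DirectSum.lof ℂ ℕ (Gr (Cl.genSpan R)) p x ∈
        (QAlg.comp (perp R) p).map (can R).toLinearMap := by
      rw [map_comp_can]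
      exact ⟨x, rfl⟩
    obtain ⟨y, _, hy⟩ := h
    exact ⟨y, hy⟩
  | add x y hx hy =>
    obtain ⟨a, rfl⟩ := hx
    obtain ⟨b, rfl⟩ := hy
    exact ⟨a + b, map_add _ _ _⟩

/-- A linear form on the Koszul dual, restricted to the component of degree `p`, comes from a
linear form on the generalized Clifford algebra vanishing on `F^{p-1}`. -/
theorem exists_form_filtPrev (hK : IsKoszul R)
    (hcentral : ∑ k, QAlg.gen R k ^ 2 ∈ Subalgebra.center ℂ (QAlg R)) (p : ℕ)
    (ξ : KoszulDual R →ₗ[ℂ] ℂ) :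
    ∃ ψ : Cl R →ₗ[ℂ] ℂ, (∀ a ∈ filtPrev (Cl.genSpan R) p, ψ a = 0) ∧
      ∀ l : List (Fin n), l.length = p → ψ (Cl.word R l) = ξ (QAlg.word (perp R) l) := by
  obtain ⟨ψ, hψ0, hψ⟩ := exists_form_of_koszulDual hK hcentral p ξ
  refine ⟨ψ, fun a ha => ?_, hψ⟩
  have h : filtPrev (Cl.genSpan R) p ≤ LinearMap.ker ψ := by
    rw [Cl.filtPrev_eq_span, Submodule.span_le]
    rintro _ ⟨l, hl, rfl⟩
    exact hψ0 l hl
  exact h ha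

/-- Linear forms separate points. The degree `p` part of each `ξ` is the pullback along `can` of a
form on the graded algebra, so it kills the kernel. Splitting an expression in words by length then
gives `ξ x = 0`. -/
theorem can_injective (hK : IsKoszul R)
    (hcentral : ∑ k, QAlg.gen R k ^ 2 ∈ Subalgebra.center ℂ (QAlg R)) :
    Function.Injective (can R) := by
  rw [injective_iff_map_eq_zero]
  intro x hx
  rw [← Module.forall_dual_apply_eq_zero_iff ℂ]
  intro ξ
  obtain ⟨c, rfl⟩ := QAlg.exists_linearCombination_word x
  have h : ∀ p, ∑ l ∈ c.support with l.length = p, c l * ξ (QAlg.word (perp R) l) = 0 := by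
    intro p
    obtain ⟨ψ, hψ0, hψ⟩ := exists_form_filtPrev hK hcentral p ξ
    obtain ⟨χ, hχ⟩ := Gr.exists_form (Cl.genSpan R) p ψ hψ0
    have h1 := congrArg χ hx
    rw [Finsupp.linearCombination_apply, Finsupp.sum, map_sum, map_sum, map_zero] at h1
    rw [← h1, Finset.sum_filter]
    refine Finset.sum_congr rfl fun l _ => ?_
    rw [map_smul, map_smul, can_word, hχ, smul_eq_mul]
    split_ifs with hl
    · rw [hψ l hl]
    · rw [mul_zero]
  rw [Finsupp.linearCombination_apply, Finsupp.sum, map_sum]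
  simp only [map_smul, smul_eq_mul]
  rw [← Finset.sum_fiberwise_of_maps_to (t := c.support.image List.length) (g := List.length)
    fun l hl => Finset.mem_image_of_mem _ hl]
  exact Finset.sum_eq_zero fun p _ => h p

/-! ### Comparison of dimensions by leading terms -/

/-- A combination of words of length `p` vanishes in the Koszul dual if and only if it lies in
`F^{p-1}` in the generalized Clifford algebra. -/
theorem linearCombination_mem_filtPrev_iff (hK : IsKoszul R)
    (hcentral : ∑ k, QAlg.gen R k ^ 2 ∈ Subalgebra.center ℂ (QAlg R)) {p : ℕ}
    {c : List (Fin n) →₀ ℂ} (hc : ∀ l ∈ c.support, l.length = p) :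
    Finsupp.linearCombination ℂ (Cl.word R) c ∈ filtPrev (Cl.genSpan R) p ↔
      Finsupp.linearCombination ℂ (QAlg.word (perp R)) c = 0 := by
  have hmem : Finsupp.linearCombination ℂ (Cl.word R) c ∈ filt (Cl.genSpan R) p :=
    Submodule.sum_mem _ fun l hl => Submodule.smul_mem _ _ (Cl.word_mem_filt (hc l hl).le)
  have hcan : can R (Finsupp.linearCombination ℂ (QAlg.word (perp R)) c) =
      DirectSum.lof ℂ ℕ (Gr (Cl.genSpan R)) p (Gr.cls _ p _ hmem) := by
    -- The representatives `w l` lie in the fixed step `F^p`, which avoids transporting along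
    -- `l.length = p` inside the sum.
    have h : ∀ l : List (Fin n), ∃ w : filt (Cl.genSpan R) p, l.length = p →
        w.1 = Cl.word R l ∧ can R (QAlg.word (perp R) l) =
          DirectSum.lof ℂ ℕ (Gr (Cl.genSpan R)) p (Gr.mkQ _ p w) := by
      intro l
      by_cases hl : l.length = p
      · subst hl
        exact ⟨⟨_, Cl.word_mem_filt le_rfl⟩, fun _ => ⟨rfl, can_word l⟩⟩
      · exact ⟨0, fun h => absurd h hl⟩
    choose w hw using h
    have h1 : (⟨_, hmem⟩ : filt (Cl.genSpan R) p) = ∑ l ∈ c.support, c l • w l := by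
      apply Subtype.ext
      rw [AddSubmonoidClass.coe_finsetSum]
      exact Finset.sum_congr rfl fun l hl => by
        rw [Submodule.coe_smul, (hw l (hc l hl)).1]
        rfl
    rw [Gr.cls, h1, Finsupp.linearCombination_apply, Finsupp.sum]
    simp only [map_sum, map_smul]
    exact Finset.sum_congr rfl fun l hl => by rw [(hw l (hc l hl)).2]
  rw [← Gr.cls_eq_zero _ hmem, ← map_eq_zero_iff _ (can_injective hK hcentral), hcan]
  exact (map_eq_zero_iff (DirectSum.of _ p) (DirectSum.of_injective _)).symm

theorem length_of_mem_support_filter {α : Type} (c : List α →₀ ℂ) (p : ℕ) :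
    ∀ l ∈ (c.filter fun l => l.length = p).support, l.length = p := by
  intro l hl
  rw [Finsupp.support_filter, Finset.mem_filter] at hl
  exact hl.2

/-- The homogeneous components of a relation in a quadratic algebra are relations. -/
theorem QAlg.linearCombination_filter_eq_zero {c : List (Fin n) →₀ ℂ}
    (hc : Finsupp.linearCombination ℂ (QAlg.word R) c = 0) (p : ℕ) :
    Finsupp.linearCombination ℂ (QAlg.word R) (c.filter fun l => l.length = p) = 0 := by
  rw [← Module.forall_dual_apply_eq_zero_iff ℂ]
  intro ξ
  -- Truncating `ξ` to words of length `p` still gives a form on the algebra, because the relations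
  -- are homogeneous.
  obtain ⟨ψ, hψ⟩ := QAlg.exists_form (R := R)
    (fun l => if l.length = p then ξ (QAlg.word R l) else 0) (by
      intro r hr u v
      by_cases h : u.length + v.length + 2 = p
      · have h1 := congrArg ξ (QAlg.word_relation hr u v)
        simp only [map_sum, map_smul, map_zero, smul_eq_mul] at h1
        refine Eq.trans ?_ h1
        refine Finset.sum_congr rfl fun k _ => Finset.sum_congr rfl fun l _ => ?_
        rw [if_pos (by simp; omega)]
      · refine Finset.sum_eq_zero fun k _ => Finset.sum_eq_zero fun l _ => ?_
        rw [if_neg (by simp; omega), mul_zero])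
  have h1 := congrArg ψ hc
  rw [Finsupp.linearCombination_apply, Finsupp.sum, map_sum, map_zero] at h1
  rw [← h1, Finsupp.linearCombination_apply, Finsupp.sum, map_sum, Finsupp.support_filter,
    Finset.sum_filter]
  refine Finset.sum_congr rfl fun l _ => ?_
  rw [map_smul ξ, map_smul ψ, hψ]
  split_ifs with hl
  · rw [Finsupp.filter_apply_pos (fun l : List (Fin n) => l.length = p) _ hl]
  · rw [smul_zero]

/-- A set of words forming a basis of the Koszul dual spans the generalized Clifford algebra. -/
theorem Cl.span_image_word (hK : IsKoszul R)
    (hcentral : ∑ k, QAlg.gen R k ^ 2 ∈ Subalgebra.center ℂ (QAlg R)) {b : Set (List (Fin n))}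
    (hb : Set.range (QAlg.word (perp R)) ⊆ Submodule.span ℂ (QAlg.word (perp R) '' b)) :
    Submodule.span ℂ (Cl.word R '' b) = ⊤ := by
  have hword : ∀ p, ∀ l : List (Fin n), l.length < p →
      Cl.word R l ∈ Submodule.span ℂ (Cl.word R '' b) := by
    intro p
    induction p with
    | zero => exact fun l hl => absurd hl (Nat.not_lt_zero _)
    | succ p ih =>
      intro l hl
      rcases Nat.lt_succ_iff_lt_or_eq.1 hl with hl | hl
      · exact ih l hl
      obtain ⟨c, hcb, hc⟩ :=
        (Finsupp.mem_span_image_iff_linearCombination ℂ).1 (hb ⟨l, rfl⟩)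
      have h0 : Finsupp.linearCombination ℂ (QAlg.word (perp R)) (Finsupp.single l 1 - c) = 0 := by
        rw [map_sub, hc, Finsupp.linearCombination_single, one_smul, sub_self]
      -- The degree `p` part of the relation `l - c` in `A^!` shows that in `Cℓ(A)` the word `l`
      -- equals a combination of words of `b` up to `F^{p-1}`, which the induction covers.
      have h1 := (linearCombination_mem_filtPrev_iff hK hcentral (p := p) 
        (length_of_mem_support_filter _ p)).2
        (QAlg.linearCombination_filter_eq_zero h0 p)
      rw [Finsupp.filter_sub,
        Finsupp.filter_single_of_pos (fun m : List (Fin n) => m.length = p) hl, map_sub,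
        Finsupp.linearCombination_single, one_smul] at h1
      have h2 : filtPrev (Cl.genSpan R) p ≤ Submodule.span ℂ (Cl.word R '' b) := by
        rw [Cl.filtPrev_eq_span, Submodule.span_le]
        rintro _ ⟨m, hm, rfl⟩
        exact ih m hm
      rw [← sub_add_cancel (Cl.word R l)
        (Finsupp.linearCombination ℂ (Cl.word R) (c.filter fun m => m.length = p))]
      refine Submodule.add_mem _ (h2 h1)
        ((Finsupp.mem_span_image_iff_linearCombination ℂ).2 ⟨_, ?_, rfl⟩)
      rw [Finsupp.mem_supported] at hcb ⊢
      exact subset_trans (Finset.coe_subset.2 (by simp)) hcb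
  rw [eq_top_iff, ← Cl.span_word, Submodule.span_le]
  rintro _ ⟨l, rfl⟩
  exact hword _ l (Nat.lt_succ_self _)

/-- A set of words linearly independent in the Koszul dual is linearly independent in the
generalized Clifford algebra. -/
theorem Cl.linearIndepOn_word (hK : IsKoszul R)
    (hcentral : ∑ k, QAlg.gen R k ^ 2 ∈ Subalgebra.center ℂ (QAlg R)) {b : Set (List (Fin n))}
    (hb : LinearIndepOn ℂ (QAlg.word (perp R)) b) : LinearIndepOn ℂ (Cl.word R) b := by
  rw [linearIndepOn_iff] at hb ⊢
  intro c hcb hc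
  by_contra hne
  -- The longest words of a vanishing combination sum to an element of `F^{p-1}`, `p` being their
  -- length. This leading part therefore vanishes in `A^!`, against independence there.
  obtain ⟨l, hl, hmax⟩ := Finset.exists_max_image c.support List.length
    (Finsupp.support_nonempty_iff.2 hne)
  have h1 : Finsupp.linearCombination ℂ (Cl.word R)
      (c.filter fun m => m.length = l.length) ∈ filtPrev (Cl.genSpan R) l.length := by
    have h2 := congrArg (Finsupp.linearCombination ℂ (Cl.word R))
      (Finsupp.filter_add_filter_not c fun m => m.length = l.length)
    rw [map_add, hc] at h2
    rw [eq_neg_of_add_eq_zero_left h2, neg_mem_iff, Cl.filtPrev_eq_span]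
    refine (Finsupp.mem_span_image_iff_linearCombination ℂ).2 ⟨_, ?_, rfl⟩
    rw [Finsupp.mem_supported]
    intro m hm
    rw [Finset.mem_coe, Finsupp.support_filter, Finset.mem_filter] at hm
    exact lt_of_le_of_ne (hmax m hm.1) hm.2
  have h3 := (linearCombination_mem_filtPrev_iff hK hcentral 
    (length_of_mem_support_filter c l.length)).1 h1
  have h4 := hb _ (by
    rw [Finsupp.mem_supported] at hcb ⊢
    exact subset_trans (Finset.coe_subset.2 (by simp)) hcb) h3
  have h5 := DFunLike.congr_fun h4 l
  rw [Finsupp.filter_apply_pos (fun m : List (Fin n) => m.length = l.length) _ rfl] at h5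
  exact Finsupp.mem_support_iff.1 hl h5

/-- A maximal set of words independent in `A^!` indexes a basis of both algebras; no finiteness of
dimension is needed. -/
theorem rank_cl_eq_rank_koszulDual (hK : IsKoszul R)
    (hcentral : ∑ k, QAlg.gen R k ^ 2 ∈ Subalgebra.center ℂ (QAlg R)) :
    Module.rank ℂ (Cl R) = Module.rank ℂ (KoszulDual R) := by
  obtain ⟨b, -, -, hspan, hind⟩ := exists_linearIndepOn_extension
    (linearIndepOn_empty ℂ (QAlg.word (perp R))) (Set.empty_subset Set.univ)
  rw [Set.image_univ] at hspan
  have h1 : Submodule.span ℂ (QAlg.word (perp R) '' b) = ⊤ := by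
    rw [eq_top_iff, ← QAlg.span_word, Submodule.span_le]
    exact hspan
  have h2 := Cl.span_image_word hK hcentral hspan
  rw [Set.image_eq_range] at h1 h2
  exact (Module.Basis.mk (Cl.linearIndepOn_word hK hcentral hind) h2.ge).mk_eq_rank''.symm.trans
    (Module.Basis.mk hind h1.ge).mk_eq_rank''

end Canonical

end NCEuclid

open NCEuclid in
/-- Let `A = A(E, R)`, `E = ℂ^n`, be a quadratic `*`-algebra with hermitian generators `x^1, …, x^n`
which is Koszul and in which `∑_k (x^k)^2` is central. Then `can : A^! → gr(Cℓ(A))` is an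
isomorphism of graded algebras, and `dim Cℓ(A) = dim A^!`. -/
theorem proposition2p3 (n : ℕ) (R : Submodule ℂ (Matrix (Fin n) (Fin n) ℂ))
    (hstar : ∀ r ∈ R, r.conjTranspose ∈ R)
    (hkoszul : IsKoszul R)
    (hcentral : ∑ k, QAlg.gen R k ^ 2 ∈ Subalgebra.center ℂ (QAlg R)) :
    Function.Bijective (can R) ∧
    (∀ p : ℕ, (QAlg.comp (perp R) p).map (can R).toLinearMap =
      LinearMap.range (DirectSum.lof ℂ ℕ (Gr (Cl.genSpan R)) p)) ∧
    Module.rank ℂ (Cl R) = Module.rank ℂ (KoszulDual R) :=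
  ⟨⟨can_injective hkoszul hcentral, can_surjective⟩, map_comp_can,
    rank_cl_eq_rank_koszulDual hkoszul hcentral⟩
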